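/- For an odd integer $t\ge 3$, a $t$-Schur overpartition of a nonnegative integer $m$ is an overpartition of $m$ (a partition of $m$ in which the first occurrence of each part size may be overlined) all of whose parts are congruent modulo $2t$ to an element of $\{1,3,5,\dots,2t-1\}\setminus\{t\}$. Let $\overline{S}_t(m)$ denote the number of $t$-Schur overpartitions of $m$; equivalently, $$\sum_{m\ge 0}\overline{S}_t(m)q^m=\prod_{k\ge 1}\frac{(1+q^{2k-1})(1-q^{t(2k-1)})}{(1+q^{t(2k-1)})(1-q^{2k-1})}.$$ Theorem. For all integers $\alpha\ge 0$, $n\ge 0$ and $1\le i\le 4$, $$\overline{S}_3\bigl(24\cdot 5^{2\alpha+2}n+24\cdot 5^{2\alpha+1}i+4\cdot 5^{2\alpha+2}\bigr)\equiv 0 \pmod 3.$$ -/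

import Mathlib

/-- The set `I(t) = {1, 3, 5, …, 2t - 1} \ {t}` of admissible residues modulo `2t`. -/
def schurResidues (t : ℕ) : Finset ℕ :=
  ((Finset.range t).image fun j => 2 * j + 1).erase t

/-- `p` is a `t`-Schur partition of `n`: each part is congruent modulo `2t` to some `i ∈ I(t)`. -/
def IsSchurPartition (t : ℕ) {n : ℕ} (p : n.Partition) : Prop :=
  ∀ m ∈ p.parts, ∃ i ∈ schurResidues t, m ≡ i [MOD 2 * t]

instance (t n : ℕ) : DecidablePred (IsSchurPartition t (n := n)) := fun p =>
  inferInstanceAs (Decidable (∀ m ∈ p.parts, ∃ i ∈ schurResidues t, m ≡ i [MOD 2 * t]))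

/-- The `t`-Schur overpartitions of `n`. An overpartition of `n` is a partition of `n` in which the
first occurrence of each part size may be overlined; it is encoded as the underlying partition `p`
together with the set of those part sizes of `p` whose first occurrence is overlined. -/
def schurOverpartitions (t n : ℕ) : Finset (Σ _ : n.Partition, Finset ℕ) :=
  (Finset.univ.filter fun p : n.Partition => IsSchurPartition t p).sigma
    fun p => p.parts.toFinset.powerset

/-- The number of `t`-Schur overpartitions of `n`. -/
def schurOverpartitionCount (t n : ℕ) : ℕ :=
  (schurOverpartitions t n).card

/-!
Write `φ(q) = ∑ q ^ x ^ 2` over all integers `x`, and work with power series over `ZMod 3`, where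
`f(q) ^ 3 = f(q ^ 3)`.

The generating function `S` of `3`-Schur overpartitions is the product of
`(1 + q ^ k) / (1 - q ^ k)` over the odd `k` prime to `3`. The same product `B` over all odd `k`
satisfies `B = S * B ^ 3`, because its factors at multiples of `3` form `B(q ^ 3)`; hence
`S = B ^ (-2)`. The Jacobi triple product at `z = ± 1`, which is needed only up to a common factor
even in `q` and so follows from the `q`-binomial theorem (`prod_one_add_odd_sq`), turns this into
`S = φ(-q) / φ(q)` (`schurSeries_mul_theta`).

Let `α` and `β` be the even and odd parts of `φ`. Then `α ^ 4 = α(q) * α(q ^ 3)` and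
`β ^ 4 = β(q) * β(q ^ 3)` count the representations by `x ^ 2 + 3 * y ^ 2` with `x` and `y` both
even, or both odd. Their sum is the theta series in `q ^ 4` of the hexagonal lattice, which is `1`
modulo `3` on account of the rotation of order `3` (`theta_even_add_odd_pow_four`). The terms of
`S = (α - β) / (α + β)` with exponent divisible by `4` form
`(α ^ 4 + β ^ 4) / (α ^ 4 - β ^ 4) = 1 / (1 + R)` with `R = β ^ 4`. The terms of `R` with exponent
divisible by `3` form `R(q ^ 3) = R ^ 3`, and with this the terms of `1 / (1 + R)` with exponent `4`
modulo `24` are exactly those of `-R` (`coeff_schurSeries`).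

So for `m` congruent to `4` modulo `24` the count is modulo `3`, up to sign, the number of solutions of
`x ^ 2 + 3 * y ^ 2 = m` in odd integers. There are none if `5` divides `m` to an odd power, since `-3` is not a
square modulo `5` (`sq_add_three_mul_sq_ne`).
-/

open PowerSeries

namespace SchurOverpartition

/-! ### Counting series of weight functions -/

/-- The counting series `∑ i, X ^ w i` of a weight function `w`, reduced modulo `3`: its `n`-th
coefficient is the number of elements of weight `n`. It is meaningful only when the fibres of `w`
are finite, since `Nat.card` of an infinite type is `0`. -/
noncomputable def weightSeries {ι : Type*} (w : ι → ℕ) : (ZMod 3)⟦X⟧ :=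
  PowerSeries.mk fun n => (Nat.card {i // w i = n} : ZMod 3)

lemma coeff_weightSeries {ι : Type*} (w : ι → ℕ) (n : ℕ) :
    coeff n (weightSeries w) = (Nat.card {i // w i = n} : ZMod 3) := coeff_mk _ _

lemma weightSeries_comp_equiv {ι κ : Type*} (e : ι ≃ κ) (w : κ → ℕ) :
    weightSeries (w ∘ e) = weightSeries w := by
  ext n
  rw [coeff_weightSeries, coeff_weightSeries]
  exact congrArg _ (Nat.card_congr (e.subtypeEquiv fun a => Iff.rfl))

lemma weightSeries_sum {ι κ : Type*} {w : ι → ℕ} {v : κ → ℕ}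
    (hw : ∀ n, Finite {i // w i = n}) (hv : ∀ n, Finite {i // v i = n}) :
    weightSeries (Sum.elim w v) = weightSeries w + weightSeries v := by
  ext n
  have := hw n
  have := hv n
  rw [map_add, coeff_weightSeries, coeff_weightSeries, coeff_weightSeries, ← Nat.cast_add,
    ← Nat.card_sum]
  exact congrArg _ (Nat.card_congr Equiv.subtypeSum)

lemma weightSeries_mul {ι κ : Type*} {w : ι → ℕ} {v : κ → ℕ}
    (hw : ∀ n, Finite {i // w i = n}) (hv : ∀ n, Finite {i // v i = n}) :
    weightSeries w * weightSeries v = weightSeries fun p : ι × κ => w p.1 + v p.2 := by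
  ext n
  simp only [coeff_mul, coeff_weightSeries, ← Nat.cast_mul, ← Nat.cast_sum]
  congr 1
  rw [← Finset.sum_coe_sort]
  simp only [← Nat.card_prod]
  rw [← Nat.card_sigma]
  refine Nat.card_congr
    { toFun := fun x => ⟨(x.2.1.1, x.2.2.1), ?_⟩
      invFun := fun p => ⟨⟨(w p.1.1, v p.1.2), ?_⟩, ⟨p.1.1, rfl⟩, ⟨p.1.2, rfl⟩⟩
      left_inv := ?_
      right_inv := fun p => rfl }
  · have h := Finset.HasAntidiagonal.mem_antidiagonal.1 x.1.2
    simp only [x.2.1.2, x.2.2.2, h]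
  · exact Finset.HasAntidiagonal.mem_antidiagonal.2 p.2
  · rintro ⟨⟨⟨a, b⟩, h⟩, ⟨i, hi⟩, ⟨j, hj⟩⟩
    simp only at hi hj
    subst hi hj
    rfl

lemma weightSeries_const_mul {ι : Type*} (w : ι → ℕ) {k : ℕ} (hk : k ≠ 0) :
    weightSeries (fun i => k * w i) = expand k hk (weightSeries w) := by
  ext n
  rw [coeff_expand, coeff_weightSeries]
  split_ifs with h
  · obtain ⟨m, rfl⟩ := h
    rw [Nat.mul_div_cancel_left _ (Nat.pos_of_ne_zero hk), coeff_weightSeries]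
    refine congrArg _ (Nat.card_congr (Equiv.subtypeEquivRight fun i => ?_))
    exact Nat.mul_right_inj hk
  · have : IsEmpty {i // k * w i = n} := ⟨fun i => h ⟨w i.1, i.2.symm⟩⟩
    simp

lemma expand_three_eq_pow (f : (ZMod 3)⟦X⟧) : expand 3 three_ne_zero f = f ^ 3 := by
  have h := MvPowerSeries.map_frobenius_expand (R := ZMod 3) (σ := Unit) 3 three_ne_zero (f := f)
  have h2 : frobenius (ZMod 3) 3 = RingHom.id _ := ZMod.frobenius_zmod 3
  rw [h2, MvPowerSeries.map_id] at h
  exact h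

/-! ### Series supported on a residue class -/

/-- The power series all of whose exponents lie in the residue class `r` modulo `d`. -/
def homog (d : ℕ) (r : ZMod d) : Submodule (ZMod 3) (ZMod 3)⟦X⟧ where
  carrier := {f | ∀ n : ℕ, (n : ZMod d) ≠ r → coeff n f = 0}
  add_mem' hf hg n hn := by rw [map_add, hf n hn, hg n hn, add_zero]
  zero_mem' n _ := by simp
  smul_mem' c f hf n hn := by rw [coeff_smul, hf n hn, smul_zero]

lemma mul_mem_homog {d : ℕ} {r s : ZMod d} {f g : (ZMod 3)⟦X⟧} (hf : f ∈ homog d r)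
    (hg : g ∈ homog d s) : f * g ∈ homog d (r + s) := by
  intro n hn
  rw [coeff_mul]
  refine Finset.sum_eq_zero fun p hp => ?_
  rw [Finset.HasAntidiagonal.mem_antidiagonal] at hp
  by_cases h1 : (p.1 : ZMod d) = r
  · rw [hg p.2, mul_zero]
    rintro h2
    exact hn (by rw [← hp, Nat.cast_add, h1, h2])
  · rw [hf p.1 h1, zero_mul]

lemma one_mem_homog (d : ℕ) : (1 : (ZMod 3)⟦X⟧) ∈ homog d 0 := by
  intro n hn
  rw [coeff_one, if_neg]
  rintro rfl
  exact hn Nat.cast_zero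

lemma pow_mem_homog {d : ℕ} {r : ZMod d} {f : (ZMod 3)⟦X⟧} (hf : f ∈ homog d r) (k : ℕ) :
    f ^ k ∈ homog d (k * r) := by
  induction k with
  | zero => simpa using one_mem_homog d
  | succ k ih =>
    have := mul_mem_homog ih hf
    rwa [← pow_succ, show (k : ZMod d) * r + r = ((k + 1 : ℕ) : ZMod d) * r by push_cast; ring]
      at this

lemma weightSeries_mem_homog {ι : Type*} {w : ι → ℕ} {d : ℕ} {r : ZMod d}
    (h : ∀ i, (w i : ZMod d) = r) : weightSeries w ∈ homog d r := by
  intro n hn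
  have : IsEmpty {i // w i = n} := ⟨fun i => hn (by rw [← h i.1, i.2])⟩
  simp [coeff_weightSeries]

/-- Division by a series `g` in exponents `0` modulo `d` with invertible constant term does not mix
residue classes modulo `d`. -/
lemma coeff_eq_zero_of_mul {d : ℕ} {r : ZMod d} {f g : (ZMod 3)⟦X⟧} (hg : g ∈ homog d 0)
    (hg0 : constantCoeff g = 1) (h : ∀ n : ℕ, (n : ZMod d) = r → coeff n (f * g) = 0) (n : ℕ)
    (hn : (n : ZMod d) = r) : coeff n f = 0 := by
  induction n using Nat.strong_induction_on with
  | _ n ih =>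
    have := h n hn
    rw [coeff_mul, Finset.sum_eq_single (n, 0)] at this
    · simpa [hg0] using this
    · rintro ⟨a, b⟩ hab hne
      rw [Finset.HasAntidiagonal.mem_antidiagonal] at hab
      simp only at hab ⊢
      by_cases hb : (b : ZMod d) = 0
      · have hb0 : b ≠ 0 := by
          rintro rfl
          exact hne (by simpa using hab)
        rw [ih a (by omega) (by rw [← hn, ← hab, Nat.cast_add, hb, add_zero]), zero_mul]
      · rw [hg b hb, mul_zero]
    · simp

/-! ### Theta series of arithmetic progressions -/

/-- The theta series `∑ a : ℤ, X ^ (d * a + r) ^ 2` modulo `3`. -/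
noncomputable def thetaSeries (d r : ℤ) : (ZMod 3)⟦X⟧ :=
  weightSeries fun a : ℤ => (d * a + r).natAbs ^ 2

lemma finite_theta_fibre {d : ℤ} (hd : d ≠ 0) (r : ℤ) (n : ℕ) :
    Finite {a : ℤ // (d * a + r).natAbs ^ 2 = n} := by
  have hfin : (Set.Icc (-(n : ℤ)) n).Finite := Set.finite_Icc _ _
  have hinj : Function.Injective fun a : ℤ => d * a + r := fun a b h => by
    simpa [hd] using h
  have := hfin.preimage (f := fun a : ℤ => d * a + r) hinj.injOn
  refine Set.Finite.subset this fun a ha => ?_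
  have h1 : (d * a + r).natAbs ^ 2 = n := ha
  have h2 := Nat.le_self_pow two_ne_zero (d * a + r).natAbs
  simp only [Set.mem_preimage, Set.mem_Icc]
  omega

lemma finite_const_mul_fibre {ι : Type*} {w : ι → ℕ} (hw : ∀ n, Finite {i // w i = n}) {k : ℕ}
    (hk : k ≠ 0) (n : ℕ) : Finite {i // k * w i = n} := by
  by_cases h : k ∣ n
  · obtain ⟨m, rfl⟩ := h
    refine Set.Finite.subset (hw m : Set.Finite {i | w i = m}) fun i hi => ?_
    exact (Nat.mul_right_inj hk).1 hi
  · have : IsEmpty {i // k * w i = n} := ⟨fun i => h ⟨w i.1, i.2.symm⟩⟩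
    infer_instance

lemma thetaSeries_pow_three (d r : ℤ) :
    thetaSeries d r ^ 3 = weightSeries fun a : ℤ => 3 * (d * a + r).natAbs ^ 2 := by
  rw [weightSeries_const_mul _ three_ne_zero, expand_three_eq_pow]
  rfl

lemma finite_sum_fibre {ι κ : Type*} {w : ι → ℕ} {v : κ → ℕ}
    (hw : ∀ n, Finite {i // w i = n}) (hv : ∀ n, Finite {i // v i = n}) (n : ℕ) :
    Finite {p // Sum.elim w v p = n} := by
  have : Finite {i // Sum.elim w v (Sum.inl i) = n} := hw n
  have : Finite {i // Sum.elim w v (Sum.inr i) = n} := hv n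
  exact Finite.of_equiv _ Equiv.subtypeSum.symm

lemma finite_prod_fibre {ι κ : Type*} {w : ι → ℕ} {v : κ → ℕ}
    (hw : ∀ n, Finite {i // w i = n}) (hv : ∀ n, Finite {i // v i = n}) (n : ℕ) :
    Finite {p : ι × κ // w p.1 + v p.2 = n} := by
  have h1 : (⋃ m ∈ Set.Iic n, {i | w i = m}).Finite :=
    (Set.finite_Iic n).biUnion fun m _ => hw m
  have h2 : (⋃ m ∈ Set.Iic n, {i | v i = m}).Finite :=
    (Set.finite_Iic n).biUnion fun m _ => hv m
  refine Set.Finite.subset (h1.prod h2) fun p hp => ?_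
  have hp' : w p.1 + v p.2 = n := hp
  simp only [Set.mem_prod, Set.mem_iUnion, Set.mem_Iic, Set.mem_ofPred_eq, exists_prop]
  exact ⟨⟨_, by omega, rfl⟩, ⟨_, by omega, rfl⟩⟩

/-- Modulo `3` the product of the theta series in `X` and in `X ^ 3` counts the representations by
`x ^ 2 + 3 * y ^ 2`. -/
lemma thetaSeries_mul_pow_three {d : ℤ} (hd : d ≠ 0) (r : ℤ) :
    thetaSeries d r * thetaSeries d r ^ 3 =
      weightSeries fun p : ℤ × ℤ => (d * p.1 + r).natAbs ^ 2 + 3 * (d * p.2 + r).natAbs ^ 2 := by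
  rw [thetaSeries_pow_three, thetaSeries,
    weightSeries_mul (finite_theta_fibre hd r)
      (finite_const_mul_fibre (finite_theta_fibre hd r) three_ne_zero)]

/-- The pairs of integers `(x, y)` with `x ≡ y [ZMOD 2]`, split into the even and the odd ones, are
the pairs `(2 * u + v, v)`. -/
def sameParityEquiv : (ℤ × ℤ) ⊕ (ℤ × ℤ) ≃ ℤ × ℤ where
  toFun := Sum.elim (fun p => (p.1 - p.2, 2 * p.2)) (fun p => (p.1 - p.2, 2 * p.2 + 1))
  invFun p := if p.2 % 2 = 0 then Sum.inl (p.1 + p.2 / 2, p.2 / 2)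
    else Sum.inr (p.1 + p.2 / 2, p.2 / 2)
  left_inv := by
    rintro (⟨a, b⟩ | ⟨a, b⟩)
    · have h1 : 2 * b / 2 = b := by omega
      simp [h1]
    · have h1 : (2 * b + 1) / 2 = b := by omega
      have h2 : (2 * b + 1) % 2 = 1 := by omega
      simp [h1, h2]
  right_inv := by
    rintro ⟨u, v⟩
    by_cases h : v % 2 = 0
    · simp only [h, if_true, Sum.elim_inl, Prod.mk.injEq]
      omega
    · simp only [h, if_false, Sum.elim_inr, Prod.mk.injEq]
      omega

/-- The number of representations of `n ≠ 0` by `u ^ 2 + u * v + v ^ 2` is divisible by `3`: the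
rotation `(u, v) ↦ (v, -u - v)` preserves the form, has order `3` and has no nonzero fixed
point. -/
lemma weightSeries_hexagonal (hfin : ∀ n, Finite {p : ℤ × ℤ //
      4 * (p.1 ^ 2 + p.1 * p.2 + p.2 ^ 2).natAbs = n}) :
    weightSeries (fun p : ℤ × ℤ => 4 * (p.1 ^ 2 + p.1 * p.2 + p.2 ^ 2).natAbs) = 1 := by
  classical
  have hpos : ∀ u v : ℤ, u ^ 2 + u * v + v ^ 2 = 0 → u = 0 ∧ v = 0 := by
    intro u v h
    have hv : v ^ 2 = 0 := by nlinarith [sq_nonneg (2 * u + v), sq_nonneg v]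
    have hv' : v = 0 := by simpa using hv
    subst hv'
    simpa using h
  ext n
  rw [coeff_weightSeries, coeff_one]
  have := hfin n
  let _ := Fintype.ofFinite {p : ℤ × ℤ // 4 * (p.1 ^ 2 + p.1 * p.2 + p.2 ^ 2).natAbs = n}
  split_ifs with hn
  · subst hn
    have : Nat.card {p : ℤ × ℤ // 4 * (p.1 ^ 2 + p.1 * p.2 + p.2 ^ 2).natAbs = 0} = 1 := by
      rw [Nat.card_eq_one_iff_unique]
      refine ⟨⟨?_⟩, ⟨⟨(0, 0), by simp⟩⟩⟩
      have key : ∀ p : {p : ℤ × ℤ // 4 * (p.1 ^ 2 + p.1 * p.2 + p.2 ^ 2).natAbs = 0},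
          p.1 = (0, 0) := by
        rintro ⟨⟨u, v⟩, h⟩
        obtain ⟨rfl, rfl⟩ := hpos u v (by simp only at h; omega)
        rfl
      intro p q
      exact Subtype.ext ((key p).trans (key q).symm)
    rw [this, Nat.cast_one]
  · let f : Function.End {p : ℤ × ℤ // 4 * (p.1 ^ 2 + p.1 * p.2 + p.2 ^ 2).natAbs = n} :=
      fun p => ⟨(p.1.2, -p.1.1 - p.1.2), by
        refine Eq.trans ?_ p.2
        dsimp only
        congr 2
        ring⟩
    have hf : f ^ 3 ^ 1 = 1 := by
      funext p
      refine Subtype.ext (Prod.ext ?_ ?_)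
      · change -p.1.2 - (-p.1.1 - p.1.2) = p.1.1
        ring
      · change -(-p.1.1 - p.1.2) - (-p.1.2 - (-p.1.1 - p.1.2)) = p.1.2
        ring
    have hcard := Equiv.Perm.card_fixedPoints_modEq hf
    have hempty : IsEmpty (Function.fixedPoints f) := by
      refine ⟨?_⟩
      rintro ⟨⟨⟨u, v⟩, h⟩, hfix⟩
      have h1 := congrArg (fun p => p.1.1) (hfix : f _ = _)
      have h2 := congrArg (fun p => p.1.2) (hfix : f _ = _)
      change v = u at h1
      change -u - v = v at h2
      obtain ⟨rfl, rfl⟩ : u = 0 ∧ v = 0 := by omega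
      exact hn (by simpa using h.symm)
    rw [Fintype.card_eq_zero (α := Function.fixedPoints f)] at hcard
    rw [Nat.card_eq_fintype_card]
    exact (ZMod.natCast_eq_natCast_iff _ 0 3).2 hcard

/-- The theta series of the hexagonal lattice is `1` modulo `3`; here it is assembled from the even
and the odd representations by `x ^ 2 + 3 * y ^ 2`. -/
lemma theta_even_add_odd_pow_four : thetaSeries 2 0 ^ 4 + thetaSeries 2 1 ^ 4 = 1 := by
  have key : ∀ p, Sum.elim
      (fun p : ℤ × ℤ => (2 * p.1 + 0).natAbs ^ 2 + 3 * (2 * p.2 + 0).natAbs ^ 2)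
      (fun p : ℤ × ℤ => (2 * p.1 + 1).natAbs ^ 2 + 3 * (2 * p.2 + 1).natAbs ^ 2) p =
      ((fun p : ℤ × ℤ => 4 * (p.1 ^ 2 + p.1 * p.2 + p.2 ^ 2).natAbs) ∘ sameParityEquiv) p := by
    have hnn : ∀ u v : ℤ, 0 ≤ u ^ 2 + u * v + v ^ 2 := fun u v => by
      nlinarith [sq_nonneg (2 * u + v), sq_nonneg v]
    rintro (⟨a, b⟩ | ⟨a, b⟩)
    · simp only [Sum.elim_inl, Function.comp, sameParityEquiv, Equiv.coe_fn_mk]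
      zify
      rw [sq_abs, sq_abs, abs_of_nonneg (hnn _ _)]
      ring
    · simp only [Sum.elim_inr, Function.comp, sameParityEquiv, Equiv.coe_fn_mk]
      zify
      rw [sq_abs, sq_abs, abs_of_nonneg (hnn _ _)]
      ring
  have hfin (r : ℤ) := finite_prod_fibre (finite_theta_fibre two_ne_zero r)
    (finite_const_mul_fibre (finite_theta_fibre two_ne_zero r) three_ne_zero)
  rw [pow_succ' _ 3, pow_succ' _ 3, thetaSeries_mul_pow_three two_ne_zero,
    thetaSeries_mul_pow_three two_ne_zero, ← weightSeries_sum (hfin 0) (hfin 1), funext key,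
    weightSeries_comp_equiv]
  refine weightSeries_hexagonal fun n => ?_
  have : Finite {p // Sum.elim
      (fun p : ℤ × ℤ => (2 * p.1 + 0).natAbs ^ 2 + 3 * (2 * p.2 + 0).natAbs ^ 2)
      (fun p : ℤ × ℤ => (2 * p.1 + 1).natAbs ^ 2 + 3 * (2 * p.2 + 1).natAbs ^ 2) p = n} := by
    exact finite_sum_fibre (hfin 0) (hfin 1) n
  simp only [key] at this
  exact @Finite.of_equiv _ _ this (sameParityEquiv.subtypeEquiv fun p => Iff.rfl)

lemma thetaSeries_even_mem : thetaSeries 2 0 ∈ homog 4 0 := by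
  refine weightSeries_mem_homog fun a => ?_
  rw [show (2 * a + 0).natAbs ^ 2 = 4 * a.natAbs ^ 2 by zify; rw [sq_abs, sq_abs]; ring]
  rw [Nat.cast_mul]
  exact zero_mul _

lemma natAbs_sq_cast (d : ℕ) (x : ℤ) : ((x.natAbs ^ 2 : ℕ) : ZMod d) = (x : ZMod d) ^ 2 := by
  rw [← Int.cast_natCast, Nat.cast_pow, Int.natCast_natAbs, sq_abs, Int.cast_pow]

lemma thetaSeries_odd_mem_eight : thetaSeries 2 1 ∈ homog 8 1 := by
  refine weightSeries_mem_homog fun a => ?_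
  rw [natAbs_sq_cast]
  push_cast
  generalize (a : ZMod 8) = z
  revert z
  decide

lemma homog_of_dvd {d e : ℕ} (h : d ∣ e) {r : ℕ} {f : (ZMod 3)⟦X⟧} (hf : f ∈ homog e r) :
    f ∈ homog d r := by
  intro n hn
  refine hf n fun hne => hn ?_
  rw [ZMod.natCast_eq_natCast_iff] at hne ⊢
  exact hne.of_dvd h

lemma thetaSeries_six_mem {r : ℤ} (hr : ∀ z : ZMod 24, (6 * z + r) ^ 2 = 1) :
    thetaSeries 6 r ∈ homog 24 1 := by
  refine weightSeries_mem_homog fun a => ?_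
  rw [natAbs_sq_cast]
  push_cast
  exact hr _

/-- The integers split into the residue classes `1`, `0` and `2` modulo `3`. -/
def residueThreeEquiv : ℤ ⊕ (ℤ ⊕ ℤ) ≃ ℤ where
  toFun := Sum.elim (fun c => 3 * c + 1) (Sum.elim (fun c => 3 * c) (fun c => 3 * c + 2))
  invFun a := if a % 3 = 1 then Sum.inl (a / 3) else
    Sum.inr (if a % 3 = 0 then Sum.inl (a / 3) else Sum.inr (a / 3))
  left_inv := by
    rintro (c | c | c)
    · have h1 : (3 * c + 1) / 3 = c := by omega
      have h2 : (3 * c + 1) % 3 = 1 := by omega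
      simp [h1, h2]
    · have h1 : (3 * c) / 3 = c := by omega
      have h2 : (3 * c) % 3 = 0 := by omega
      simp [h2]
    · have h1 : (3 * c + 2) / 3 = c := by omega
      have h2 : (3 * c + 2) % 3 = 2 := by omega
      simp [h1, h2]
  right_inv := by
    intro a
    dsimp only
    split_ifs <;> simp only [Sum.elim_inl, Sum.elim_inr] <;> omega

/-- Splitting the odd squares by divisibility by `3`; modulo `3`, the part divisible by `3` is the
ninth power of the whole. -/
lemma thetaSeries_odd_split :
    thetaSeries 2 1 = thetaSeries 2 1 ^ 9 + (thetaSeries 6 1 + thetaSeries 6 5) := by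
  have h9 : thetaSeries 2 1 ^ 9 = thetaSeries 6 3 := by
    have h3 : ∀ a : ℤ, (6 * a + 3).natAbs ^ 2 = 3 * (3 * (2 * a + 1).natAbs ^ 2) := by
      intro a
      zify
      rw [sq_abs, sq_abs]
      ring
    rw [thetaSeries, thetaSeries, funext h3, weightSeries_const_mul _ three_ne_zero,
      weightSeries_const_mul _ three_ne_zero, expand_three_eq_pow, expand_three_eq_pow, ← pow_mul]
  have h6 : (6 : ℤ) ≠ 0 := by norm_num
  have hfin15 (n : ℕ) : Finite {p // Sum.elim (fun a : ℤ => (6 * a + 1).natAbs ^ 2)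
      (fun a : ℤ => (6 * a + 5).natAbs ^ 2) p = n} :=
    finite_sum_fibre (finite_theta_fibre h6 1) (finite_theta_fibre h6 5) n
  rw [h9, thetaSeries, thetaSeries, thetaSeries, thetaSeries,
    ← weightSeries_sum (finite_theta_fibre h6 1) (finite_theta_fibre h6 5),
    ← weightSeries_sum (finite_theta_fibre h6 3) hfin15,
    ← weightSeries_comp_equiv residueThreeEquiv]
  congr 1
  funext p
  rcases p with c | c | c <;>
  simp only [Function.comp, residueThreeEquiv, Equiv.coe_fn_mk, Sum.elim_inl, Sum.elim_inr] <;>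
  congr 2 <;> ring

/-- The integers split into the even and the odd ones. -/
def parityEquiv : ℤ ⊕ ℤ ≃ ℤ where
  toFun := Sum.elim (fun a => 2 * a) (fun a => 2 * a + 1)
  invFun a := if a % 2 = 0 then Sum.inl (a / 2) else Sum.inr (a / 2)
  left_inv := by
    rintro (a | a)
    · simp
    · have h1 : (2 * a + 1) / 2 = a := by omega
      have h2 : (2 * a + 1) % 2 = 1 := by omega
      simp [h1, h2]
  right_inv := by
    intro a
    dsimp only
    split_ifs <;> simp only [Sum.elim_inl, Sum.elim_inr] <;> omega

lemma thetaSeries_eq_even_add_odd : thetaSeries 1 0 = thetaSeries 2 0 + thetaSeries 2 1 := by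
  rw [thetaSeries, thetaSeries, thetaSeries,
    ← weightSeries_sum (finite_theta_fibre two_ne_zero 0) (finite_theta_fibre two_ne_zero 1),
    ← weightSeries_comp_equiv parityEquiv]
  congr 1
  funext p
  rcases p with a | a <;>
  simp only [Function.comp, parityEquiv, Equiv.coe_fn_mk, Sum.elim_inl, Sum.elim_inr] <;>
  congr 2 <;> ring

lemma evalNegHom_theta : evalNegHom (thetaSeries 1 0) = thetaSeries 2 0 - thetaSeries 2 1 := by
  have hmod : ∀ {f : (ZMod 3)⟦X⟧} {r n : ℕ}, f ∈ homog 2 r → n % 2 ≠ r % 2 → coeff n f = 0 := by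
    intro f r n hf hn
    refine hf n fun h => hn ?_
    exact (ZMod.natCast_eq_natCast_iff _ _ _).1 h
  have hA : thetaSeries 2 0 ∈ homog 2 (0 : ℕ) :=
    homog_of_dvd (e := 4) (by norm_num) (by simpa using thetaSeries_even_mem)
  have hB : thetaSeries 2 1 ∈ homog 2 (1 : ℕ) :=
    homog_of_dvd (e := 8) (by norm_num) (by simpa using thetaSeries_odd_mem_eight)
  ext n
  rw [thetaSeries_eq_even_add_odd, evalNegHom, coeff_rescale, map_add, map_sub]
  rcases Nat.even_or_odd n with h | h
  · rw [h.neg_one_pow, hmod hB (by have := Nat.even_iff.1 h; omega)]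
    ring
  · rw [h.neg_one_pow, hmod hA (by have := Nat.odd_iff.1 h; omega)]
    ring

/-! ### Gaussian binomial coefficients and the product formula for theta series -/

section GaussianBinomial

variable {R : Type*} [CommRing R]

/-- The Gaussian binomial coefficient `[m, k]` at the parameter `p`. -/
def gaussBinom (p : R) : ℕ → ℕ → R
  | _, 0 => 1
  | 0, _ + 1 => 0
  | m + 1, k + 1 => gaussBinom p m k + p ^ (k + 1) * gaussBinom p m (k + 1)

@[simp]
lemma gaussBinom_zero_right (p : R) (m : ℕ) : gaussBinom p m 0 = 1 := by
  cases m <;> rfl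

lemma gaussBinom_succ_succ (p : R) (m k : ℕ) : gaussBinom p (m + 1) (k + 1) =
    gaussBinom p m k + p ^ (k + 1) * gaussBinom p m (k + 1) := rfl

lemma gaussBinom_eq_zero (p : R) {m k : ℕ} (h : m < k) : gaussBinom p m k = 0 := by
  induction m generalizing k with
  | zero =>
    obtain ⟨k, rfl⟩ := Nat.exists_eq_succ_of_ne_zero h.ne'
    rfl
  | succ m ih =>
    obtain ⟨k, rfl⟩ := Nat.exists_eq_succ_of_ne_zero (Nat.ne_zero_of_lt h)
    rw [Nat.succ_eq_add_one, gaussBinom_succ_succ, ih (by omega), ih (by omega)]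
    ring

/-- The second Pascal rule, with `m = k + l`. -/
lemma gaussBinom_succ_succ' (p : R) (k l : ℕ) : gaussBinom p (k + l + 1) (k + 1) =
    p ^ l * gaussBinom p (k + l) k + gaussBinom p (k + l) (k + 1) := by
  induction h : k + l generalizing k l with
  | zero =>
    obtain ⟨rfl, rfl⟩ : k = 0 ∧ l = 0 := by omega
    simp [gaussBinom]
  | succ m ih =>
    rw [gaussBinom_succ_succ p (m + 1)]
    rcases l with _ | l
    · rw [gaussBinom_eq_zero p (show m + 1 < k + 1 by omega)]
      simp
    have h1 := ih k l (by omega)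
    rcases k with _ | k
    · have h2 := gaussBinom_succ_succ p m 0
      rw [gaussBinom_zero_right] at h1 h2 ⊢
      linear_combination p * h1 - h2
    · have h2 := ih k (l + 1) (by omega)
      have h3 := gaussBinom_succ_succ p m k
      have h4 := gaussBinom_succ_succ p m (k + 1)
      linear_combination h2 + p ^ (k + 2) * h1 - p ^ (l + 1) * h3 - h4

lemma map_gaussBinom {S : Type*} [CommRing S] (f : R →+* S) (p : R) (m k : ℕ) :
    f (gaussBinom p m k) = gaussBinom (f p) m k := by
  induction m generalizing k with
  | zero => cases k <;> simp [gaussBinom]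
  | succ m ih => cases k <;> simp [gaussBinom, ih]

/-- The `q`-binomial theorem. -/
lemma prod_add_pow_eq_sum_gaussBinom (p y : R) (m : ℕ) : ∏ k ∈ Finset.range m, (y + p ^ k) =
    ∑ i ∈ Finset.range (m + 1), gaussBinom p m i * p ^ (i.choose 2) * y ^ (m - i) := by
  induction m with
  | zero => simp
  | succ m ih =>
    rw [Finset.prod_range_succ, ih, mul_add, Finset.sum_mul, Finset.sum_mul,
      Finset.sum_range_succ' _ (m + 1)]
    have h1 : ∑ i ∈ Finset.range (m + 1),
        gaussBinom p m i * p ^ (i.choose 2) * y ^ (m - i) * y =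
        ∑ i ∈ Finset.range (m + 1),
        gaussBinom p m (i + 1) * p ^ ((i + 1).choose 2) * y ^ (m - i) + y ^ (m + 1) := by
      rw [Finset.sum_range_succ', Finset.sum_range_succ, gaussBinom_eq_zero p (Nat.lt_succ_self m)]
      congr 1
      · rw [zero_mul, zero_mul, add_zero]
        refine Finset.sum_congr rfl fun i hi => ?_
        rw [Finset.mem_range] at hi
        rw [mul_assoc, ← pow_succ, show m - (i + 1) + 1 = m - i by omega]
      · simp [pow_succ]
    rw [h1, add_right_comm, ← Finset.sum_add_distrib]
    congr 1
    · refine Finset.sum_congr rfl fun i hi => ?_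
      rw [Finset.mem_range] at hi
      obtain ⟨l, rfl⟩ := Nat.exists_eq_add_of_le (Nat.lt_succ_iff.1 hi)
      rw [gaussBinom_succ_succ', Nat.choose_succ_succ' i 1, Nat.choose_one_right,
        show i + l + 1 - (i + 1) = l by omega, show i + l - i = l by omega]
      ring
    · simp

/-- Consecutive Gaussian binomials agree up to order `min (k + 1) (m - k)`. -/
lemma dvd_gaussBinom_sub {p : R} {m k s : ℕ} (hk : s ≤ k + 1) (hm : s + k ≤ m) :
    p ^ s ∣ gaussBinom p m (k + 1) - gaussBinom p m k := by
  obtain ⟨l, rfl⟩ := Nat.exists_eq_add_of_le (show k ≤ m by omega)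
  have h1 := gaussBinom_succ_succ p (k + l) k
  rw [gaussBinom_succ_succ'] at h1
  have h2 : gaussBinom p (k + l) (k + 1) - gaussBinom p (k + l) k =
      p ^ (k + 1) * gaussBinom p (k + l) (k + 1) - p ^ l * gaussBinom p (k + l) k := by
    linear_combination h1
  rw [h2]
  exact dvd_sub ((pow_dvd_pow p hk).mul_right _) ((pow_dvd_pow p (by omega)).mul_right _)

lemma dvd_gaussBinom_sub_central {p : R} (n j : ℕ) (hj : j ≤ n) :
    p ^ (n - j) ∣ gaussBinom p (2 * n) (n + j) - gaussBinom p (2 * n) n ∧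
    p ^ (n - j) ∣ gaussBinom p (2 * n) (n - j) - gaussBinom p (2 * n) n := by
  induction j with
  | zero => simp
  | succ j ih =>
    obtain ⟨h1, h2⟩ := ih (by omega)
    have hle := pow_dvd_pow p (show n - (j + 1) ≤ n - j by omega)
    have h3 := dvd_gaussBinom_sub (p := p) (m := 2 * n) (k := n + j) (s := n - (j + 1))
      (by omega) (by omega)
    have h4 := dvd_gaussBinom_sub (p := p) (m := 2 * n) (k := n - (j + 1)) (s := n - (j + 1))
      (by omega) (by omega)
    rw [show n - (j + 1) + 1 = n - j by omega] at h4
    constructor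
    · have := dvd_add h3 (hle.trans h1)
      rwa [sub_add_sub_cancel] at this
    · have := dvd_sub (hle.trans h2) h4
      rwa [sub_sub_sub_cancel_left] at this

end GaussianBinomial

/-- A finite form of the Jacobi triple product at `z = 1`. Up to a power of `X`, it is the
`q`-binomial theorem for `2 * (n + 1)` factors with `p = X ^ 2` and `y = X ^ (2 * n + 1)`: the lower
and the upper half of the factors `y + p ^ k` both give the product over `l`. -/
lemma prod_one_add_odd_sq (n : ℕ) :
    (∏ l ∈ Finset.range (n + 1), (1 + X ^ (2 * l + 1) : (ZMod 3)⟦X⟧)) ^ 2 =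
      ∑ i ∈ Finset.range (2 * (n + 1) + 1), gaussBinom (X ^ 2) (2 * (n + 1)) i *
        X ^ (((i : ℤ) - (n + 1)).natAbs ^ 2) := by
  have hX : (X : (ZMod 3)⟦X⟧) ^ ((n + 1) * (3 * n + 1)) ≠ 0 := pow_ne_zero _ X_ne_zero
  refine mul_left_cancel₀ hX ?_
  have h := prod_add_pow_eq_sum_gaussBinom (X ^ 2 : (ZMod 3)⟦X⟧) (X ^ (2 * n + 1)) (2 * (n + 1))
  have hlow : ∏ k ∈ Finset.range (n + 1), (X ^ (2 * n + 1) + (X ^ 2) ^ k : (ZMod 3)⟦X⟧) =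
      X ^ (n * (n + 1)) * ∏ l ∈ Finset.range (n + 1), (1 + X ^ (2 * l + 1) : (ZMod 3)⟦X⟧) := by
    have h1 : ∀ k ∈ Finset.range (n + 1), (X ^ (2 * n + 1) + (X ^ 2) ^ k : (ZMod 3)⟦X⟧) =
        (X ^ 2) ^ k * (1 + X ^ (2 * (n + 1 - 1 - k) + 1)) := by
      intro k hk
      rw [Finset.mem_range] at hk
      obtain ⟨l, rfl⟩ := Nat.exists_eq_add_of_le (Nat.lt_succ_iff.1 hk)
      rw [show k + l + 1 - 1 - k = l by omega]
      ring
    rw [Finset.prod_congr rfl h1, Finset.prod_mul_distrib,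
      Finset.prod_range_reflect (fun l => (1 + X ^ (2 * l + 1) : (ZMod 3)⟦X⟧)),
      Finset.prod_pow_eq_pow_sum, ← pow_mul]
    congr 2
    have := Finset.sum_range_id_mul_two (n + 1)
    rw [Nat.add_sub_cancel] at this
    linarith
  have hhigh : ∏ k ∈ Finset.range (n + 1),
      (X ^ (2 * n + 1) + (X ^ 2) ^ (n + 1 + k) : (ZMod 3)⟦X⟧) =
      X ^ ((2 * n + 1) * (n + 1)) *
        ∏ l ∈ Finset.range (n + 1), (1 + X ^ (2 * l + 1) : (ZMod 3)⟦X⟧) := by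
    have h1 : ∀ k ∈ Finset.range (n + 1),
        (X ^ (2 * n + 1) + (X ^ 2) ^ (n + 1 + k) : (ZMod 3)⟦X⟧) =
        X ^ (2 * n + 1) * (1 + X ^ (2 * k + 1)) := by
      intro k _
      ring
    rw [Finset.prod_congr rfl h1, Finset.prod_mul_distrib, Finset.prod_const, Finset.card_range,
      ← pow_mul]
  rw [two_mul (n + 1), Finset.prod_range_add, hlow, hhigh, ← two_mul] at h
  rw [Finset.mul_sum]
  refine Eq.trans ?_ (h.trans (Finset.sum_congr rfl fun i hi => ?_))
  · ring
  · rw [Finset.mem_range] at hi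
    rw [mul_left_comm, mul_assoc, ← pow_mul, ← pow_mul, ← pow_add, ← pow_add]
    congr 2
    have hc : 2 * i.choose 2 + i = i * i := by
      rcases i with _ | i
      · rfl
      · rw [Nat.choose_two_right, Nat.mul_div_cancel' (Nat.even_mul_pred_self (i + 1)).two_dvd,
          Nat.add_sub_cancel]
        ring
    obtain ⟨l, hl⟩ := Nat.exists_eq_add_of_le (Nat.lt_succ_iff.1 hi)
    rw [hl, Nat.add_sub_cancel_left]
    zify at hc hl ⊢
    rw [sq_abs]
    linear_combination hc - (2 * (n : ℤ) + 1) * hl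

/-- The truncated product `∏ (1 + X ^ (2 * l + 1)) ^ 2` is, to growing order, a multiple of the
theta series; the multiplier involves even powers of `X` only. -/
lemma dvd_prod_one_add_odd_sq_sub (n : ℕ) : (X : (ZMod 3)⟦X⟧) ^ (n + 1) ∣
    (∏ l ∈ Finset.range (n + 1), (1 + X ^ (2 * l + 1) : (ZMod 3)⟦X⟧)) ^ 2 -
      gaussBinom (X ^ 2) (2 * (n + 1)) (n + 1) * thetaSeries 1 0 := by
  set c : (ZMod 3)⟦X⟧ := gaussBinom (X ^ 2) (2 * (n + 1)) (n + 1) with hc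
  set e : ℕ → ℕ := fun i => ((i : ℤ) - (n + 1)).natAbs ^ 2 with he
  have h1 : (X : (ZMod 3)⟦X⟧) ^ (n + 1) ∣
      ∑ i ∈ Finset.range (2 * (n + 1) + 1), X ^ e i - thetaSeries 1 0 := by
    rw [X_pow_dvd_iff]
    intro N hN
    rw [map_sub, map_sum, thetaSeries, coeff_weightSeries, sub_eq_zero]
    simp only [coeff_X_pow]
    rw [Finset.sum_boole, ← Nat.card_eq_finsetCard]
    have hle : ∀ a : ℤ, (1 * a + 0).natAbs ^ 2 = N → a.natAbs ≤ n := fun a ha => by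
      have := Nat.le_self_pow two_ne_zero (1 * a + 0).natAbs
      omega
    refine congrArg _ (Nat.card_congr
      { toFun := fun i => ⟨(i.1 : ℤ) - (n + 1), ?_⟩
        invFun := fun a => ⟨(a.1 + (n + 1)).toNat, ?_⟩
        left_inv := fun i => Subtype.ext ?_
        right_inv := fun a => Subtype.ext ?_ })
    · rw [one_mul, add_zero]
      exact (Finset.mem_filter.1 i.2).2.symm
    · have h := hle a.1 a.2
      refine Finset.mem_filter.2 ⟨Finset.mem_range.2 (by omega), a.2.symm.trans ?_⟩
      simp only [he]
      congr 1
      omega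
    · simp only
      omega
    · have h := hle a.1 a.2
      simp only
      omega
  have h2 : ∀ i ∈ Finset.range (2 * (n + 1) + 1), (X : (ZMod 3)⟦X⟧) ^ (n + 1) ∣
      (gaussBinom (X ^ 2) (2 * (n + 1)) i - c) * X ^ e i := by
    intro i hi
    rw [Finset.mem_range] at hi
    have hkey : ∀ j ≤ n + 1, n + 1 ≤ 2 * (n + 1 - j) + j ^ 2 := by
      intro j hj
      obtain ⟨k, hk⟩ := Nat.exists_eq_add_of_le hj
      rw [hk, Nat.add_sub_cancel_left]
      rcases j with _ | j
      · omega
      · nlinarith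
    rcases le_total (n + 1) i with h | h
    · obtain ⟨j, rfl⟩ := Nat.exists_eq_add_of_le h
      have hd := (dvd_gaussBinom_sub_central (p := (X ^ 2 : (ZMod 3)⟦X⟧)) (n + 1) j (by omega)).1
      have hej : e (n + 1 + j) = j ^ 2 := by
        simp only [he]; congr 1; omega
      rw [hej]
      refine (pow_dvd_pow X (hkey j (by omega))).trans ?_
      rw [pow_add, pow_mul]
      exact mul_dvd_mul_right hd _
    · obtain ⟨j, hj⟩ := Nat.exists_eq_add_of_le h
      have hd := (dvd_gaussBinom_sub_central (p := (X ^ 2 : (ZMod 3)⟦X⟧)) (n + 1) j (by omega)).2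
      obtain rfl : i = n + 1 - j := by omega
      have hej : e (n + 1 - j) = j ^ 2 := by
        simp only [he]; congr 1; omega
      rw [hej]
      refine (pow_dvd_pow X (hkey j (by omega))).trans ?_
      rw [pow_add, pow_mul]
      exact mul_dvd_mul_right hd _
  rw [prod_one_add_odd_sq]
  have h3 := dvd_add (Finset.dvd_sum h2) (h1.mul_left c)
  have h4 : ∑ i ∈ Finset.range (2 * (n + 1) + 1),
      (gaussBinom (X ^ 2) (2 * (n + 1)) i - c) * X ^ e i +
      c * (∑ i ∈ Finset.range (2 * (n + 1) + 1), X ^ e i - thetaSeries 1 0) =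
      ∑ i ∈ Finset.range (2 * (n + 1) + 1), gaussBinom (X ^ 2) (2 * (n + 1)) i * X ^ e i -
      c * thetaSeries 1 0 := by
    simp only [sub_mul, Finset.sum_sub_distrib, mul_sub, Finset.mul_sum]
    ring
  rwa [h4] at h3

lemma evalNegHom_X_dvd {n : ℕ} {f : (ZMod 3)⟦X⟧} (h : X ^ n ∣ f) : X ^ n ∣ evalNegHom f := by
  have := map_dvd evalNegHom h
  rw [map_pow, evalNegHom_X, neg_pow] at this
  exact dvd_of_mul_left_dvd this

/-- Crossing out the common multiplier: the truncated form of
`φ(-q) * ∏ (1 + q ^ (2 * l + 1)) ^ 2 = φ(q) * ∏ (1 - q ^ (2 * l + 1)) ^ 2`. -/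
lemma dvd_theta_mul_prod_sub (n : ℕ) : (X : (ZMod 3)⟦X⟧) ^ (n + 1) ∣
    evalNegHom (thetaSeries 1 0) *
      (∏ l ∈ Finset.range (n + 1), (1 + X ^ (2 * l + 1) : (ZMod 3)⟦X⟧)) ^ 2 -
    thetaSeries 1 0 * (∏ l ∈ Finset.range (n + 1), (1 - X ^ (2 * l + 1) : (ZMod 3)⟦X⟧)) ^ 2 := by
  have h1 := dvd_prod_one_add_odd_sq_sub n
  have h2 := evalNegHom_X_dvd h1
  have h3 : evalNegHom (gaussBinom (X ^ 2 : (ZMod 3)⟦X⟧) (2 * (n + 1)) (n + 1)) =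
      gaussBinom (X ^ 2) (2 * (n + 1)) (n + 1) := by
    rw [map_gaussBinom, map_pow, evalNegHom_X, neg_sq]
  have h4 : ∀ l, evalNegHom (1 + X ^ (2 * l + 1) : (ZMod 3)⟦X⟧) = 1 - X ^ (2 * l + 1) := by
    intro l
    rw [map_add, map_one, map_pow, evalNegHom_X, Odd.neg_pow ⟨l, rfl⟩, sub_eq_add_neg]
  rw [map_sub, map_pow, map_prod, map_mul, h3, Finset.prod_congr rfl fun l _ => h4 l] at h2
  convert dvd_sub (h1.mul_left (evalNegHom (thetaSeries 1 0))) (h2.mul_left (thetaSeries 1 0))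
    using 1
  ring

/-! ### The generating function -/

open scoped PowerSeries.WithPiTopology

/-- The generating function of `3`-Schur overpartitions, reduced modulo `3`. -/
noncomputable def schurSeries : (ZMod 3)⟦X⟧ :=
  PowerSeries.mk fun n => (schurOverpartitionCount 3 n : ZMod 3)

lemma isSchurPartition_three_iff {n : ℕ} (p : n.Partition) :
    IsSchurPartition 3 p ↔ ∀ m ∈ p.parts, m % 6 = 1 ∨ m % 6 = 5 := by
  have h : schurResidues 3 = {1, 5} := by decide
  simp [IsSchurPartition, h, Nat.ModEq]

lemma schurSeries_eq_genFun : schurSeries =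
    Nat.Partition.genFun fun i _ => if i % 6 = 1 ∨ i % 6 = 5 then (2 : ZMod 3) else 0 := by
  ext n
  rw [schurSeries, coeff_mk, Nat.Partition.coeff_genFun, schurOverpartitionCount,
    schurOverpartitions, Finset.card_sigma, Nat.cast_sum, Finset.sum_filter]
  refine Finset.sum_congr rfl fun p _ => ?_
  rw [Finset.card_powerset, Finsupp.prod, Multiset.toFinsupp_support]
  split_ifs with h
  · rw [isSchurPartition_three_iff] at h
    rw [Finset.prod_congr rfl fun i hi => if_pos (h i (Multiset.mem_toFinset.1 hi)),
      Finset.prod_const]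
    push_cast
    rfl
  · rw [isSchurPartition_three_iff] at h
    push Not at h
    obtain ⟨m, hm, h1, h2⟩ := h
    exact (Finset.prod_eq_zero (Multiset.mem_toFinset.2 hm) (if_neg (by tauto))).symm

/-- The Euler factor `(1 + X ^ k) / (1 - X ^ k) = 1 + 2 * ∑ j ≥ 1, X ^ (k * j)` counting the
occurrences of the part `k` in an overpartition. -/
noncomputable def overFactor (k : ℕ) : (ZMod 3)⟦X⟧ :=
  1 + ∑' j : ℕ, (2 : ZMod 3) • X ^ (k * (j + 1))

lemma overFactor_mul {k : ℕ} (hk : k ≠ 0) : overFactor k * (1 - X ^ k) = 1 + X ^ k := by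
  have h0 : constantCoeff (X ^ k : (ZMod 3)⟦X⟧) = 0 := by simp [hk]
  have hs := WithPiTopology.summable_pow_of_constantCoeff_eq_zero h0
  have h1 := WithPiTopology.tsum_pow_mul_one_sub_of_constantCoeff_eq_zero h0
  have h2 : ∀ j : ℕ, (2 : ZMod 3) • (X : (ZMod 3)⟦X⟧) ^ (k * (j + 1)) =
      (2 * X ^ k) * (X ^ k) ^ j := by
    intro j
    rw [smul_eq_C_mul, pow_mul, pow_succ', map_ofNat, mul_assoc]
  rw [overFactor, tsum_congr h2, hs.tsum_mul_left]
  linear_combination (2 * X ^ k) * h1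

lemma one_sub_X_pow_ne_zero {k : ℕ} (hk : k ≠ 0) : (1 - X ^ k : (ZMod 3)⟦X⟧) ≠ 0 := by
  intro h
  simpa [hk] using congrArg constantCoeff h

lemma overFactor_pow_three {k : ℕ} (hk : k ≠ 0) : overFactor k ^ 3 = overFactor (3 * k) := by
  have h1 : (overFactor k * (1 - X ^ k)) ^ 3 = (1 + X ^ k) ^ 3 := by rw [overFactor_mul hk]
  rw [mul_pow, ← expand_three_eq_pow (1 - X ^ k), ← expand_three_eq_pow (1 + X ^ k), map_sub,
    map_add, map_one, map_pow, expand_X, ← pow_mul] at h1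
  refine mul_right_cancel₀ (one_sub_X_pow_ne_zero (mul_ne_zero three_ne_zero hk)) ?_
  rw [h1, overFactor_mul (mul_ne_zero three_ne_zero hk)]

lemma hasProd_genFun_overFactor (P : ℕ → Prop) [DecidablePred P] :
    HasProd (fun i => if P (i + 1) then overFactor (i + 1) else 1)
      (Nat.Partition.genFun fun i _ => if P i then (2 : ZMod 3) else 0) := by
  have h : (fun i => if P (i + 1) then overFactor (i + 1) else 1) = fun i =>
      1 + ∑' j, (if P (i + 1) then (2 : ZMod 3) else 0) • X ^ ((i + 1) * (j + 1)) := by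
    funext i
    split_ifs
    · rfl
    · simp
  rw [h]
  exact Nat.Partition.hasProd_genFun fun i _ => if P i then (2 : ZMod 3) else 0

/-- `S * B ^ 2 = 1`, where `B` is the product of the Euler factors of all odd parts: the factors of
the odd multiples of `3` form `B(X ^ 3)`, which is `B ^ 3` modulo `3`. -/
lemma exists_hasProd_overFactor_odd : ∃ B : (ZMod 3)⟦X⟧,
    HasProd (fun l : ℕ => overFactor (2 * l + 1)) B ∧ schurSeries * B ^ 2 = 1 := by
  set B : (ZMod 3)⟦X⟧ :=
    Nat.Partition.genFun fun i _ => if i % 2 = 1 then (2 : ZMod 3) else 0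
  have hB := hasProd_genFun_overFactor (fun i => i % 2 = 1)
  have hS := hasProd_genFun_overFactor (fun i => i % 6 = 1 ∨ i % 6 = 5)
  rw [← schurSeries_eq_genFun] at hS
  have hB3 : HasProd (fun i => if (i + 1) % 6 = 3 then overFactor (i + 1) else 1) (B ^ 3) := by
    have hinj : Function.Injective fun i : ℕ => 3 * i + 2 := fun a b h => by
      simp only at h; omega
    rw [← hinj.hasProd_iff]
    · convert (hB.mul hB).mul hB using 1
      · funext i
        simp only [Function.comp]
        by_cases h : (i + 1) % 2 = 1
        · rw [if_pos h, if_pos (by omega), show 3 * i + 2 + 1 = 3 * (i + 1) by ring,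
            ← overFactor_pow_three (Nat.succ_ne_zero i)]
          ring
        · rw [if_neg h, if_neg (by omega), one_mul, one_mul]
      · ring
    · intro i hi
      rw [if_neg]
      intro h
      exact hi ⟨i / 3, by simp only; omega⟩
  have hSB : HasProd (fun i => if (i + 1) % 2 = 1 then overFactor (i + 1) else 1)
      (schurSeries * B ^ 3) := by
    convert hS.mul hB3 using 2 with i
    by_cases h3 : (i + 1) % 6 = 3
    · rw [if_pos h3, if_pos (by omega), if_neg (by omega), one_mul]
    · rw [if_neg h3, mul_one]
      refine if_congr ?_ rfl rfl
      omega
  have hodd : HasProd (fun l : ℕ => overFactor (2 * l + 1)) B := by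
    have hinj : Function.Injective fun i : ℕ => 2 * i := fun a b h => by
      simp only at h; omega
    rw [← hinj.hasProd_iff] at hB
    · convert hB using 1
      funext l
      simp only [Function.comp]
      rw [if_pos (by omega)]
    · intro i hi
      rw [if_neg]
      intro h
      exact hi ⟨i / 2, by simp only; omega⟩
  refine ⟨B, hodd, ?_⟩
  have hB0 : B ≠ 0 := by
    intro h
    have := congrArg (coeff 0) h
    rw [Nat.Partition.coeff_genFun] at this
    simp at this
  have heq := hSB.unique hB
  refine mul_right_cancel₀ hB0 ?_
  rw [one_mul]
  refine Eq.trans ?_ heq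
  ring

lemma tendsto_order_X_pow_odd (c : ZMod 3) : Filter.Tendsto
    (fun l : ℕ => (C c * X ^ (2 * l + 1) : (ZMod 3)⟦X⟧).order) Filter.atTop (nhds ⊤) := by
  refine ENat.tendsto_nhds_top_iff_natCast_lt.mpr fun n => Filter.eventually_atTop.mpr ⟨n, ?_⟩
  intro l hl
  grw [← le_order_mul, order_X_pow]
  refine lt_add_of_nonneg_of_lt (by simp) ?_
  norm_cast
  omega

/-- Modulo `3`, the generating function of `3`-Schur overpartitions is `φ(-q) / φ(q)`. -/
lemma schurSeries_mul_theta :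
    schurSeries * thetaSeries 1 0 = evalNegHom (thetaSeries 1 0) := by
  obtain ⟨B, hB, hSB⟩ := exists_hasProd_overFactor_odd
  have hV := (WithPiTopology.multipliable_one_add_of_tendsto_order_atTop_nhds_top (ZMod 3)
    (tendsto_order_X_pow_odd 1)).hasProd
  have hU := (WithPiTopology.multipliable_one_add_of_tendsto_order_atTop_nhds_top (ZMod 3)
    (tendsto_order_X_pow_odd (-1))).hasProd
  simp only [map_one, one_mul, map_neg, neg_mul, ← sub_eq_add_neg] at hV hU
  set V : (ZMod 3)⟦X⟧ := ∏' l : ℕ, (1 + X ^ (2 * l + 1))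
  set U : (ZMod 3)⟦X⟧ := ∏' l : ℕ, (1 - X ^ (2 * l + 1))
  have hBU : B * U = V := by
    have h := hB.mul hU
    rw [funext fun l => overFactor_mul (Nat.succ_ne_zero (2 * l))] at h
    exact h.unique hV
  have hlim : evalNegHom (thetaSeries 1 0) * V ^ 2 - thetaSeries 1 0 * U ^ 2 = 0 := by
    have ht := ((hV.tendsto_prod_nat.pow 2).const_mul (evalNegHom (thetaSeries 1 0))).sub
      ((hU.tendsto_prod_nat.pow 2).const_mul (thetaSeries 1 0))
    rw [WithPiTopology.tendsto_iff_coeff_tendsto] at ht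
    ext m
    refine tendsto_nhds_unique (ht m) (tendsto_const_nhds.congr' ?_)
    filter_upwards [Filter.eventually_ge_atTop (m + 1)] with n hn
    obtain ⟨k, rfl⟩ := Nat.exists_eq_add_of_le' (show 1 ≤ n by omega)
    rw [map_zero, X_pow_dvd_iff.1 (dvd_theta_mul_prod_sub k) m (by omega)]
  have hV0 : V ≠ 0 := by
    intro h
    have h1 := hV.map (constantCoeff (R := ZMod 3)) (WithPiTopology.continuous_constantCoeff _)
    have h2 : (constantCoeff (R := ZMod 3) ∘ fun l : ℕ => (1 + X ^ (2 * l + 1) : (ZMod 3)⟦X⟧)) =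
        fun _ => 1 := by
      funext l
      simp
    rw [h2, h, map_zero] at h1
    exact zero_ne_one (h1.unique hasProd_one)
  refine mul_right_cancel₀ (pow_ne_zero 2 hV0) ?_
  rw [sub_eq_zero.1 hlim, ← hBU]
  linear_combination (thetaSeries 1 0 * U ^ 2) * hSB

/-! ### Extraction of the exponents `4` modulo `24` -/

/-- In the exponents `4` modulo `24` the series `S` is `-R`, where `R` is the theta series of
`x ^ 2 + 3 * y ^ 2` on pairs of odd integers. With `A` and `B` the even and odd parts of `φ`,
`R = B ^ 4` and `A ^ 4 = 1 - R`, so `S * (A + B) = A - B` gives `S * (1 + R) = 1 + T`, where the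
exponents of `T` are not divisible by `4`. Multiplying by `(1 - R) * (1 - R ^ 2) ^ 2` makes the
left-hand factor `1 - R ^ 6`, with exponents divisible by `24`, and on the right the splitting
`R = R ^ 3 + Q` into exponents `12` and `4` modulo `24` isolates `- Q * (1 - R ^ 6)`. -/
lemma coeff_schurSeries {n : ℕ} (hn : n % 24 = 4) :
    coeff n schurSeries = -coeff n (thetaSeries 2 1 ^ 4) := by
  set A := thetaSeries 2 0 with hA
  set B := thetaSeries 2 1 with hB
  set Q := (thetaSeries 6 1 + thetaSeries 6 5) * B ^ 3 with hQ
  have three : (3 : (ZMod 3)⟦X⟧) = 0 := by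
    have : (C (3 : ZMod 3) : (ZMod 3)⟦X⟧) = 0 := by
      rw [show (3 : ZMod 3) = 0 from rfl, map_zero]
    rwa [map_ofNat] at this
  have hAB : A ^ 4 + B ^ 4 = 1 := theta_even_add_odd_pow_four
  have hS : schurSeries * (A + B) = A - B := by
    rw [hA, hB, ← thetaSeries_eq_even_add_odd, ← evalNegHom_theta]
    exact schurSeries_mul_theta
  have hBQ : B ^ 4 = B ^ 12 + Q := by
    have h := thetaSeries_odd_split
    rw [← hB] at h
    linear_combination B ^ 3 * h
  -- Residue classes of the exponents of the building blocks.
  have hA4 : A ∈ homog 4 0 := thetaSeries_even_mem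
  have hB8 : B ∈ homog 8 1 := thetaSeries_odd_mem_eight
  have hB4 : B ∈ homog 4 1 := by
    simpa using homog_of_dvd (d := 4) (e := 8) (r := 1) (by norm_num) (by simpa using hB8)
  have hB3 : B ^ 3 ∈ homog 24 3 := by
    rw [hB, thetaSeries_pow_three]
    refine weightSeries_mem_homog fun a => ?_
    rw [Nat.cast_mul, natAbs_sq_cast]
    push_cast
    generalize (a : ZMod 24) = z
    revert z
    decide
  have hQ24 : Q ∈ homog 24 4 := by
    have h := mul_mem_homog (Submodule.add_mem _
      (thetaSeries_six_mem (r := 1) (by decide)) (thetaSeries_six_mem (r := 5) (by decide))) hB3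
    rwa [show (1 : ZMod 24) + 3 = 4 from rfl] at h
  have hR24 : B ^ 12 ∈ homog 24 12 := by
    have h := pow_mem_homog hB3 4
    rwa [← pow_mul, show ((4 : ℕ) : ZMod 24) * 3 = 12 from rfl] at h
  have hR6 : 1 - B ^ 24 ∈ homog 24 0 := by
    have h := pow_mem_homog hR24 2
    rw [← pow_mul, show ((2 : ℕ) : ZMod 24) * 12 = 0 from rfl] at h
    exact Submodule.sub_mem _ (one_mem_homog 24) h
  -- Multiplied by `1 + B ^ 4`, the series `E` becomes `(1 - B ^ 8) ^ 3`, which is `1 - B ^ 24`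
  -- modulo `3`.
  set E := (1 - B ^ 4) * (1 - B ^ 8) ^ 2 with hE
  have hE4 : E ∈ homog 4 0 := by
    have h1 := pow_mem_homog hB4 4
    have h2 := pow_mem_homog hB4 8
    rw [show ((4 : ℕ) : ZMod 4) * 1 = 0 from rfl] at h1
    rw [show ((8 : ℕ) : ZMod 4) * 1 = 0 from rfl] at h2
    have h3 := mul_mem_homog (Submodule.sub_mem _ (one_mem_homog 4) h1)
      (pow_mem_homog (Submodule.sub_mem _ (one_mem_homog 4) h2) 2)
    rwa [mul_zero, add_zero] at h3
  -- No summand on the right has a term with exponent `4` modulo `24`.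
  have key : (schurSeries + Q) * (1 - B ^ 24) =
      2 * (A ^ 2 * B ^ 2 * E) - 2 * (A ^ 3 * B * E) - 2 * (A * B ^ 3 * E) +
      (1 + B ^ 8 + B ^ 16) + B ^ 12 - B ^ 12 * (B ^ 12) ^ 2 - B ^ 12 * Q ^ 2 := by
    have h1 : schurSeries * (1 + B ^ 4) =
        1 + (2 * (A ^ 2 * B ^ 2) - 2 * (A ^ 3 * B) - 2 * (A * B ^ 3)) := by
      linear_combination (A - B) * (A ^ 2 + B ^ 2) * hS + (1 - schurSeries) * hAB +
        schurSeries * B ^ 4 * three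
    have h2 : Q = B ^ 4 - B ^ 12 := by linear_combination -hBQ
    rw [h2, hE]
    linear_combination (1 - B ^ 4) * (1 - B ^ 8) ^ 2 * h1 +
      (schurSeries * (B ^ 8 - B ^ 16) - B ^ 8 - B ^ 28 + B ^ 36) * three
  have hzero : ∀ m : ℕ, (m : ZMod 24) = (4 : ℕ) →
      coeff m ((schurSeries + Q) * (1 - B ^ 24)) = 0 := by
    intro m hm
    have hm24 : m % 24 = 4 := (ZMod.natCast_eq_natCast_iff _ _ _).1 hm
    have h4 {r : ℕ} {f : (ZMod 3)⟦X⟧} (hr : r % 4 ≠ 0) (hf : f ∈ homog 4 (r : ZMod 4)) :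
        coeff m f = 0 := by
      refine hf m fun h => hr ?_
      have : m % 4 = r % 4 := (ZMod.natCast_eq_natCast_iff _ _ _).1 h
      omega
    have hne : (m : ZMod 24) ≠ 12 ∧ (m : ZMod 24) ≠ 20 := by
      rw [hm]
      decide
    have hm8 : (m : ZMod 8) ≠ 0 := by
      intro h
      have : m % 8 = 0 % 8 := (ZMod.natCast_eq_natCast_iff _ 0 _).1 (by simpa using h)
      omega
    have t1 : coeff m (A ^ 2 * B ^ 2 * E) = 0 := h4 (r := 2) (by norm_num)
      (mul_mem_homog (mul_mem_homog (pow_mem_homog hA4 2) (pow_mem_homog hB4 2)) hE4)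
    have t2 : coeff m (A ^ 3 * B * E) = 0 := h4 (r := 1) (by norm_num)
      (mul_mem_homog (mul_mem_homog (pow_mem_homog hA4 3) hB4) hE4)
    have t3 : coeff m (A * B ^ 3 * E) = 0 := h4 (r := 3) (by norm_num)
      (mul_mem_homog (mul_mem_homog hA4 (pow_mem_homog hB4 3)) hE4)
    have t4 : coeff m (1 + B ^ 8 + B ^ 16) = 0 :=
      Submodule.add_mem (homog 8 0) (Submodule.add_mem _ (one_mem_homog 8)
        (pow_mem_homog hB8 8)) (pow_mem_homog hB8 16) m hm8
    have t5 : coeff m (B ^ 12 * (B ^ 12) ^ 2) = 0 :=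
      mul_mem_homog hR24 (pow_mem_homog hR24 2) m hne.1
    have t6 : coeff m (B ^ 12 * Q ^ 2) = 0 :=
      mul_mem_homog hR24 (pow_mem_homog hQ24 2) m hne.2
    rw [key]
    simp only [map_sub, map_add, two_mul] at t4 ⊢
    rw [t1, t2, t3, t4, t5, t6, hR24 m hne.1]
    simp
  have hconst : constantCoeff (1 - B ^ 24) = 1 := by
    have : constantCoeff B = 0 := by
      rw [← coeff_zero_eq_constantCoeff_apply]
      exact hB8 0 (by decide)
    simp [this]
  have hcast : (n : ZMod 24) = (4 : ℕ) := (ZMod.natCast_eq_natCast_iff _ _ _).2 hn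
  have h1 := coeff_eq_zero_of_mul hR6 hconst hzero n hcast
  have h2 : coeff n (B ^ 12) = 0 := hR24 n (by rw [hcast]; decide)
  rw [hBQ, map_add, h2, zero_add]
  rw [map_add] at h1
  exact eq_neg_of_add_eq_zero_left h1

/-! ### Representations by `x ^ 2 + 3 * y ^ 2` -/

lemma five_dvd_of_five_dvd_sq_add {x y : ℤ} (h : 5 ∣ x ^ 2 + 3 * y ^ 2) : 5 ∣ x ∧ 5 ∣ y := by
  have key : ∀ a b : ZMod 5, a ^ 2 + 3 * b ^ 2 = 0 → a = 0 ∧ b = 0 := by decide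
  have h0 := (ZMod.intCast_zmod_eq_zero_iff_dvd _ 5).2 h
  push_cast at h0
  obtain ⟨hx, hy⟩ := key _ _ h0
  exact ⟨(ZMod.intCast_zmod_eq_zero_iff_dvd _ 5).1 hx, (ZMod.intCast_zmod_eq_zero_iff_dvd _ 5).1 hy⟩

/-- Since `-3` is not a square modulo `5`, an integer that `5` divides to an odd power is not of the
form `x ^ 2 + 3 * y ^ 2`. -/
lemma sq_add_three_mul_sq_ne {k : ℤ} (hk : ¬ 5 ∣ k) (α : ℕ) (x y : ℤ) :
    x ^ 2 + 3 * y ^ 2 ≠ 5 ^ (2 * α + 1) * k := by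
  induction α generalizing x y with
  | zero =>
    intro h
    obtain ⟨⟨a, rfl⟩, ⟨b, rfl⟩⟩ := five_dvd_of_five_dvd_sq_add (x := x) (y := y)
      ⟨k, by rw [h]; ring⟩
    exact hk ⟨a ^ 2 + 3 * b ^ 2, by ring_nf at h; omega⟩
  | succ α ih =>
    intro h
    obtain ⟨⟨a, rfl⟩, ⟨b, rfl⟩⟩ := five_dvd_of_five_dvd_sq_add (x := x) (y := y)
      ⟨5 ^ (2 * α + 2) * k, by rw [h]; ring⟩
    refine ih a b (mul_left_cancel₀ (show (25 : ℤ) ≠ 0 by norm_num) ?_)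
    linear_combination h

end SchurOverpartition

open SchurOverpartition

theorem mainTheorem7 (α n i : ℕ) (hi₁ : 1 ≤ i) (hi₄ : i ≤ 4) :
    schurOverpartitionCount 3
      (24 * 5 ^ (2 * α + 2) * n + 24 * 5 ^ (2 * α + 1) * i + 4 * 5 ^ (2 * α + 2)) ≡ 0 [MOD 3] := by
  set m := 24 * 5 ^ (2 * α + 2) * n + 24 * 5 ^ (2 * α + 1) * i + 4 * 5 ^ (2 * α + 2) with hm
  have h25 : 5 ^ (2 * α + 2) % 6 = 1 := by
    rw [show 2 * α + 2 = 2 * (α + 1) by ring, pow_mul, Nat.pow_mod]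
    norm_num
  have hm24 : m % 24 = 4 := by
    have h1 : m = 24 * (5 ^ (2 * α + 2) * n + 5 ^ (2 * α + 1) * i) + 4 * 5 ^ (2 * α + 2) := by
      rw [hm]; ring
    omega
  have hempty : IsEmpty {p : ℤ × ℤ //
      (2 * p.1 + 1).natAbs ^ 2 + 3 * (2 * p.2 + 1).natAbs ^ 2 = m} := by
    refine ⟨fun p => ?_⟩
    have hp := congrArg (Nat.cast : ℕ → ℤ) (p.2.trans hm)
    push_cast at hp
    rw [sq_abs, sq_abs] at hp
    have hk : ¬ (5 : ℤ) ∣ 120 * n + 24 * i + 20 := by omega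
    exact sq_add_three_mul_sq_ne hk α _ _ (hp.trans (by ring))
  have hcoeff := coeff_schurSeries hm24
  rw [pow_succ' _ 3, thetaSeries_mul_pow_three two_ne_zero, coeff_weightSeries,
    Nat.card_of_isEmpty, Nat.cast_zero, neg_zero, schurSeries, PowerSeries.coeff_mk] at hcoeff
  exact (ZMod.natCast_eq_natCast_iff _ 0 3).1 hcoeff
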